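/- Let $\mathbb S^n$ be the space of real symmetric $n\times n$ matrices and let $M=\mathbb S^n_{++}\subset\mathbb S^n$ be the open cone of positive definite matrices, with the Riemannian metric $$\langle U,V\rangle_X=\operatorname{tr}(VX^{-1}UX^{-1}),\qquad X\in M,\ U,V\in T_XM=\mathbb S^n$$ (the Hessian metric of $X\mapsto-\ln\det X$), the induced Riemannian distance $d$ (infimum of lengths of piecewise smooth curves in $M$), and the exponential maps $\exp_X:T_XM\to M$, which are diffeomorphisms. For $f:M\to\mathbb R$, $X\in M$ and $V\in T_XM$ put $$f^\circ(X,V)=\limsup_{t\downarrow0,\;Y\to X}\frac{f\big(\exp_Y\,t\,(D\exp_X)_{\exp_X^{-1}Y}V\big)-f(Y)}{t},\qquad \partial^\circ f(X)=\{W\in T_XM:\ f^\circ(X,V)\ge\langle W,V\rangle_X\ \text{ for all } V\in T_XM\}.$$ The Riemannian gradient $\operatorname{grad}f(X)$ of a function $f$ differentiable at $X$ is the vector of $T_XM$ with $\langle\operatorname{grad}f(X),V\rangle_X=df_X(V)$ for all $V\in T_XM$. Let $\Omega\subset M$ be an open set (for example an open convex set), let $I$ be a finite nonempty set, let $F_i:M\to\mathbb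 R$ $(i\in I)$ be functions that are continuously differentiable on $\Omega$, and let $F(X)=\max_{i\in I}F_i(X)$. Then $F$ is locally Lipschitz on $\Omega$, that is, for each $X\in\Omega$ there are $L\ge0$ and $\delta>0$ such that $|F(Y)-F(Z)|\le L\,d(Y,Z)$ for all $Y,Z\in M$ with $d(X,Y)<\delta$ and $d(X,Z)<\delta$; and $$\partial^\circ F(X)=\operatorname{conv}\{\operatorname{grad}F_i(X):\ i\in I(X)\},\qquad X\in\Omega,$$ where $I(X)=\{i\in I:\ F_i(X)=F(X)\}$. -/

import Mathlib

open Set Filter Topology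
open scoped ContDiff

attribute [local instance] Matrix.frobeniusNormedAddCommGroup Matrix.frobeniusNormedSpace

noncomputable section

namespace SPD

/-- The real vector space of symmetric `n × n` matrices, as a subspace of all `n × n` matrices
(with the Frobenius norm). -/
def symmSubmodule (n : ℕ) : Submodule ℝ (Matrix (Fin n) (Fin n) ℝ) where
  carrier := {A | A.IsSymm}
  add_mem' := fun ha hb => Matrix.IsSymm.add ha hb
  zero_mem' := Matrix.isSymm_zero
  smul_mem' := fun c _ ha => Matrix.IsSymm.smul ha c

/-- The space of symmetric `n × n` matrices. It is also the tangent space of the manifold of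
positive definite matrices at each of its points. -/
abbrev SymMat (n : ℕ) : Type := symmSubmodule n

variable {n : ℕ}

/-- The manifold `M` of symmetric positive definite matrices, an open subset of `SymMat n`. -/
def posDef (n : ℕ) : Set (SymMat n) := {X | (X : Matrix (Fin n) (Fin n) ℝ).PosDef}

/-- The affine-invariant Riemannian metric on `M` (the Hessian metric of `X ↦ -log det X`):
`⟨U, V⟩_X = tr (V X⁻¹ U X⁻¹)`. -/
def metric (X U V : SymMat n) : ℝ :=
  Matrix.trace ((V : Matrix (Fin n) (Fin n) ℝ) * (X : Matrix (Fin n) (Fin n) ℝ)⁻¹ *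
    (U : Matrix (Fin n) (Fin n) ℝ) * (X : Matrix (Fin n) (Fin n) ℝ)⁻¹)

/-- `γ` is piecewise smooth on `[a, b]`: there is a finite partition of `[a, b]` such that `γ` is
smooth on each closed subinterval. -/
def IsPiecewiseSmooth (γ : ℝ → SymMat n) (a b : ℝ) : Prop :=
  ∃ (k : ℕ) (τ : ℕ → ℝ), Monotone τ ∧ τ 0 = a ∧ τ k = b ∧
    ∀ i < k, ContDiffOn ℝ ∞ γ (Icc (τ i) (τ (i + 1)))

/-- The Riemannian length of the curve `γ` on `[a, b]`. -/
def curveLength (γ : ℝ → SymMat n) (a b : ℝ) : ℝ :=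
  ∫ t in a..b, Real.sqrt (metric (γ t) (deriv γ t) (deriv γ t))

/-- The Riemannian distance: the infimum of the lengths of the piecewise smooth curves in `M`
that join `X` to `Y`. -/
def riemDist (X Y : SymMat n) : ℝ :=
  sInf {l : ℝ | ∃ (γ : ℝ → SymMat n) (a b : ℝ), a ≤ b ∧ IsPiecewiseSmooth γ a b ∧
    (∀ t ∈ Icc a b, γ t ∈ posDef n) ∧ γ a = X ∧ γ b = Y ∧ l = curveLength γ a b}

/-- The Christoffel symbol of the first kind of the Levi-Civita connection of the metric, in the
global chart `M ⊆ SymMat n`: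
`(∂_U ⟨V, W⟩ + ∂_V ⟨W, U⟩ - ∂_W ⟨U, V⟩) / 2` for constant vector fields `U`, `V`, `W`, which by
the Koszul formula is `⟨∇_U V, W⟩`. -/
def christoffel (X U V W : SymMat n) : ℝ :=
  (fderiv ℝ (fun Y => metric Y V W) X U + fderiv ℝ (fun Y => metric Y W U) X V -
    fderiv ℝ (fun Y => metric Y U V) X W) / 2

/-- `γ : ℝ → M` is a geodesic: `∇_{γ'} γ' = 0`, that is, `⟨γ'', W⟩ + ⟨Γ(γ', γ'), W⟩ = 0` for all
tangent vectors `W`. -/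
def IsGeodesic (γ : ℝ → SymMat n) : Prop :=
  ContDiff ℝ ∞ γ ∧ (∀ t, γ t ∈ posDef n) ∧
    ∀ (t : ℝ) (W : SymMat n),
      metric (γ t) (deriv (deriv γ) t) W + christoffel (γ t) (deriv γ t) (deriv γ t) W = 0

open Classical in
/-- The exponential map: `expMap X V = γ 1`, where `γ` is the geodesic with `γ 0 = X` and
`γ' 0 = V`. (The value `X` is a default that does not occur for `X ∈ M`, which is complete.) -/
def expMap (X V : SymMat n) : SymMat n :=
  if h : ∃ γ : ℝ → SymMat n, IsGeodesic γ ∧ γ 0 = X ∧ deriv γ 0 = V then h.choose 1 else X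

/-- The inverse `exp_X⁻¹ : M → T_X M` of the exponential map at `X`. -/
def expInv (X Y : SymMat n) : SymMat n := Function.invFun (expMap X) Y

/-- The Riemannian gradient of `f` at `X`: the tangent vector `G` with `⟨G, V⟩_X = df_X(V)` for
all tangent vectors `V`. -/
def riemGrad (f : SymMat n → ℝ) (X : SymMat n) : SymMat n :=
  Classical.epsilon fun G => ∀ V : SymMat n, metric X G V = fderiv ℝ f X V

/-- `f` is locally Lipschitz on `Ω` with respect to the Riemannian distance: each point of `Ω` is
the centre of a Riemannian ball on which `f` is Lipschitz. -/
def LocallyLipschitzOnRiem (f : SymMat n → ℝ) (Ω : Set (SymMat n)) : Prop :=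
  ∀ X ∈ Ω, ∃ L : ℝ, 0 ≤ L ∧ ∃ δ : ℝ, 0 < δ ∧
    ∀ Y ∈ posDef n, ∀ Z ∈ posDef n, riemDist X Y < δ → riemDist X Z < δ →
      |f Y - f Z| ≤ L * riemDist Y Z

/-- The generalized (Clarke) directional derivative
`f°(X, V) = limsup_{t ↓ 0, Y → X} (f (exp_Y (t (D exp_X)_{exp_X⁻¹ Y} V)) - f Y) / t`.
The upper limit is taken in the extended reals; it is finite when `f` is locally Lipschitz. -/
def clarkeDeriv (f : SymMat n → ℝ) (X V : SymMat n) : EReal :=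
  limsup (fun z : ℝ × SymMat n =>
      (((f (expMap z.2 (z.1 • fderiv ℝ (expMap X) (expInv X z.2) V)) - f z.2) / z.1 : ℝ) : EReal))
    (𝓝[>] (0 : ℝ) ×ˢ 𝓝[posDef n] X)

/-- The generalized (Clarke) subdifferential
`∂°f(X) = {W ∈ T_X M : f°(X, V) ≥ ⟨W, V⟩_X for all V ∈ T_X M}`. -/
def clarkeSubdiff (f : SymMat n → ℝ) (X : SymMat n) : Set (SymMat n) :=
  {W | ∀ V : SymMat n, ((metric X W V : ℝ) : EReal) ≤ clarkeDeriv f X V}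

/-- The pointwise maximum of a finite nonempty family of functions. -/
def maxFun {ι : Type*} [Fintype ι] [Nonempty ι] (F : ι → SymMat n → ℝ) (X : SymMat n) : ℝ :=
  Finset.univ.sup' Finset.univ_nonempty fun i => F i X

end SPD

end

/-! In the global chart the geodesic equation reads `γ'' = γ' γ⁻¹ γ'`. Along its solutions `γ⁻¹ γ'`
is constant, so `exp_Y W = Y exp (Y⁻¹ W)` (`coe_expMap`). Hence the point `p` in the Clarke quotient
satisfies `(p - Y) / t → V` as `t ↓ 0`, `Y → X` (`tendsto_inv_smul_clarkePoint_sub`), and strict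
differentiability makes the quotient of a C¹ function converge to its differential at `V`. For a
maximum this yields two bounds: each active index bounds the Clarke derivative from below
(`fderiv_le_clarkeDeriv`), and near `X` only active indices attain the maximum, which bounds it from
above (`clarkeDeriv_le`). So the Clarke derivative is the support function of the hull of the active
gradients, and Hahn–Banach identifies the subdifferential.

For the Lipschitz property, a C¹ maximum is Lipschitz near `X` for the norm, so the norm must be
controlled by the Riemannian distance. By Cauchy–Schwarz (`abs_quadForm_le`), `log (vᵀ Y v)` varies
along a curve by at most its length. Finitely many `v` determine a symmetric matrix, whence `‖Z - Y‖
≤ C (e^d - 1) ‖Y‖` (`exists_norm_sub_le`). -/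

theorem tendsto_inv_smul_sub_of_hasStrictFDerivAt {E G α : Type*} [NormedAddCommGroup E]
    [NormedSpace ℝ E] [NormedAddCommGroup G] [NormedSpace ℝ G] {f : E → G} {f' : E →L[ℝ] G} {x : E}
    (hf : HasStrictFDerivAt f f' x) {l : Filter α} {p q : α → E} {s : α → ℝ} {v : E}
    (hp : Tendsto p l (𝓝 x)) (hq : Tendsto q l (𝓝 x))
    (hv : Tendsto (fun z => (s z)⁻¹ • (p z - q z)) l (𝓝 v)) :
    Tendsto (fun z => (s z)⁻¹ • (f (p z) - f (q z))) l (𝓝 (f' v)) := by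
  have h1 := hf.isLittleO.comp_tendsto (hp.prodMk_nhds hq)
  have h2 : (fun z => (s z)⁻¹ • (f (p z) - f (q z) - f' (p z - q z))) =o[l]
      fun _ => (1 : ℝ) :=
    ((Asymptotics.isBigO_refl (fun z => (s z)⁻¹) l).smul_isLittleO h1).trans_isBigO
      (hv.isBigO_one ℝ)
  rw [Asymptotics.isLittleO_one_iff] at h2
  simpa [smul_sub] using h2.add ((f'.continuous.tendsto v).comp hv)

/-! ### Exponentials and inverses in a real Banach algebra -/

section NormedAlgebra

open NormedSpace

variable {A : Type*} [NormedRing A] [NormedAlgebra ℝ A] [CompleteSpace A]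

theorem exp_neg_mul_exp_real (a : A) : exp (-a) * exp a = 1 := by
  let : NormedAlgebra ℚ A := .restrictScalars ℚ ℝ A
  rw [← exp_add_of_commute ((Commute.refl a).neg_left), neg_add_cancel, exp_zero]

theorem hasDerivAt_const_mul_exp (x c : A) (t : ℝ) :
    HasDerivAt (fun s : ℝ => x * exp (s • c)) (x * exp (t • c) * c) t := by
  have h := (hasDerivAt_exp_smul_const (𝕂 := ℝ) c t).const_mul x
  rwa [← mul_assoc] at h

/-- The solutions of the linear equation `γ' = γ c`. -/
theorem eq_mul_exp_of_hasDerivAt {γ : ℝ → A} {c : A} (h : ∀ t, HasDerivAt γ (γ t * c) t) (t : ℝ) :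
    γ t = γ 0 * exp (t • c) := by
  -- Integrating factor.
  have hd : ∀ s, HasDerivAt (fun s : ℝ => γ s * exp (s • (-c))) 0 s := by
    intro s
    have := (h s).mul (hasDerivAt_exp_smul_const' (𝕂 := ℝ) (-c) s)
    rwa [mul_assoc (γ s), ← mul_add, neg_mul, add_neg_cancel, mul_zero] at this
  have hc : γ t * exp (t • (-c)) = γ 0 * exp ((0 : ℝ) • (-c)) :=
    is_const_of_deriv_eq_zero (fun s => (hd s).differentiableAt) (fun s => (hd s).deriv) t 0
  rw [zero_smul, exp_zero, mul_one, smul_neg] at hc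
  rw [← hc, mul_assoc, exp_neg_mul_exp_real, mul_one]

theorem hasDerivAt_ringInverse_comp {γ : ℝ → A} {v : A} {t : ℝ} (hu : IsUnit (γ t))
    (h : HasDerivAt γ v t) :
    HasDerivAt (fun s => Ring.inverse (γ s)) (-(Ring.inverse (γ t) * v * Ring.inverse (γ t))) t := by
  obtain ⟨u, hu⟩ := hu
  have h1 := hasFDerivAt_ringInverse (𝕜 := ℝ) u
  rw [hu] at h1
  have h2 := h1.comp_hasDerivAt t h
  rw [← hu, Ring.inverse_unit]
  exact h2

/-- The solutions of the geodesic equation `γ'' = γ' γ⁻¹ γ'`. -/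
theorem eq_mul_exp_of_geodesic_equation {γ γ' : ℝ → A} (hu : ∀ t, IsUnit (γ t))
    (h : ∀ t, HasDerivAt γ (γ' t) t)
    (h' : ∀ t, HasDerivAt γ' (γ' t * Ring.inverse (γ t) * γ' t) t) (t : ℝ) :
    γ t = γ 0 * exp (t • (Ring.inverse (γ 0) * γ' 0)) := by
  -- The first integral `γ⁻¹ γ'` reduces the second-order equation to a linear first-order one.
  have hd : ∀ s, HasDerivAt (fun s => Ring.inverse (γ s) * γ' s) 0 s := by
    intro s
    have := (hasDerivAt_ringInverse_comp (hu s) (h s)).mul (h' s)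
    rw [neg_mul, mul_assoc _ _ (γ' s), mul_assoc _ (γ' s), mul_assoc (γ' s), neg_add_cancel] at this
    exact this
  have hc : ∀ s, Ring.inverse (γ s) * γ' s = Ring.inverse (γ 0) * γ' 0 := fun s =>
    is_const_of_deriv_eq_zero (fun s => (hd s).differentiableAt) (fun s => (hd s).deriv) s 0
  refine eq_mul_exp_of_hasDerivAt (fun s => ?_) t
  rw [← hc s, ← mul_assoc, Ring.mul_inverse_cancel _ (hu s), one_mul]
  exact h s

theorem exists_hasFDerivAt_inverse_quadratic (τ : A →L[ℝ] ℝ) (v w : A) {x : A} (hx : IsUnit x) :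
    ∃ K : A →L[ℝ] ℝ,
      HasFDerivAt (fun y => τ (w * Ring.inverse y * v * Ring.inverse y)) K x ∧
      ∀ u, K u = -τ (w * Ring.inverse x * u * Ring.inverse x * v * Ring.inverse x) -
        τ (w * Ring.inverse x * v * Ring.inverse x * u * Ring.inverse x) := by
  obtain ⟨u, rfl⟩ := hx
  have h := hasFDerivAt_ringInverse (𝕜 := ℝ) u
  refine ⟨_, τ.hasFDerivAt.comp _ (((h.const_mul w).mul_const' v).mul' h), fun u' => ?_⟩
  simp only [Ring.inverse_unit, ContinuousLinearMap.comp_apply, add_apply,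
    smul_apply, neg_apply,
    ContinuousLinearMap.mulLeftRight_apply, MulOpposite.smul_eq_mul_unop, MulOpposite.unop_op,
    smul_eq_mul, mul_neg, neg_mul, map_add, map_neg, mul_assoc]
  ring

/-- The direction `b` moves with the filter, so the derivative of `exp` along one fixed line would
not suffice. -/
theorem tendsto_inv_smul_exp_smul_sub_one {α : Type*} {l : Filter α} {s : α → ℝ} {b : α → A}
    {b₀ : A} (hs : Tendsto s l (𝓝 0)) (hs' : ∀ᶠ z in l, s z ≠ 0) (hb : Tendsto b l (𝓝 b₀)) :
    Tendsto (fun z => (s z)⁻¹ • (exp (s z • b z) - 1)) l (𝓝 b₀) := by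
  have h := tendsto_inv_smul_sub_of_hasStrictFDerivAt (hasStrictFDerivAt_exp_zero (𝕂 := ℝ) (𝔸 := A))
    (p := fun z => s z • b z) (q := fun _ => 0) (s := s) (v := b₀)
    (by simpa using hs.smul hb) tendsto_const_nhds
    (hb.congr' (hs'.mono fun z hz => by simp [smul_smul, inv_mul_cancel₀ hz]))
  simpa [exp_zero] using h

end NormedAlgebra

/-! ### Symmetric matrices and the metric -/

namespace SPD

open NormedSpace Matrix

variable {n : ℕ}

/-- The inclusion of the symmetric matrices into all matrices. -/
def incl (n : ℕ) : SymMat n →L[ℝ] Matrix (Fin n) (Fin n) ℝ := (symmSubmodule n).subtypeL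

/-- The symmetric part of a matrix. -/
noncomputable def symPart (n : ℕ) : Matrix (Fin n) (Fin n) ℝ →L[ℝ] SymMat n :=
  LinearMap.toContinuousLinearMap
    { toFun := fun A => ⟨(1 / 2 : ℝ) • (A + Aᵀ), by
        simp [symmSubmodule, Matrix.IsSymm, add_comm]⟩
      map_add' := fun A B => by
        ext1; simp [add_add_add_comm]
      map_smul' := fun c A => by
        ext1; simp [smul_add, smul_smul, mul_comm] }

theorem coe_symPart {A : Matrix (Fin n) (Fin n) ℝ} (hA : A.IsSymm) :
    (symPart n A : Matrix (Fin n) (Fin n) ℝ) = A := by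
  change (1 / 2 : ℝ) • (A + Aᵀ) = A
  rw [hA.eq, ← two_smul ℝ A, smul_smul]; norm_num

theorem symPart_coe (X : SymMat n) : symPart n (X : Matrix (Fin n) (Fin n) ℝ) = X :=
  Subtype.ext (coe_symPart X.2)

theorem isSymm_coe (X : SymMat n) : (X : Matrix (Fin n) (Fin n) ℝ)ᵀ = X := X.2

theorem isUnit_of_mem_posDef {X : SymMat n} (hX : X ∈ posDef n) :
    IsUnit (X : Matrix (Fin n) (Fin n) ℝ) := Matrix.PosDef.isUnit hX

-- Congruence by `B⁻¹` carries `X` to the identity, reducing metric questions to the Frobenius inner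
-- product.
open scoped MatrixOrder in
theorem exists_eq_transpose_mul_self {X : SymMat n} (hX : X ∈ posDef n) :
    ∃ B : Matrix (Fin n) (Fin n) ℝ, IsUnit B ∧ (X : Matrix (Fin n) (Fin n) ℝ) = Bᵀ * B := by
  have h0 : (0 : Matrix (Fin n) (Fin n) ℝ) ≤ X := Matrix.nonneg_iff_posSemidef.2 hX.posSemidef
  obtain ⟨B, hB⟩ := CStarAlgebra.nonneg_iff_eq_star_mul_self.1 h0
  have hB' : (X : Matrix (Fin n) (Fin n) ℝ) = Bᵀ * B := by
    rw [hB, Matrix.star_eq_conjTranspose, Matrix.conjTranspose_eq_transpose_of_trivial]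
  refine ⟨B, ?_, hB'⟩
  have h1 := isUnit_of_mem_posDef hX
  rw [hB', Matrix.isUnit_iff_isUnit_det, Matrix.det_mul] at h1
  rw [Matrix.isUnit_iff_isUnit_det]
  exact isUnit_of_mul_isUnit_right h1

theorem posDef_transpose_mul_mul {X : SymMat n} (hX : X ∈ posDef n) {C : Matrix (Fin n) (Fin n) ℝ}
    (hC : IsUnit C) : (Cᵀ * (X : Matrix (Fin n) (Fin n) ℝ) * C).PosDef := by
  have h := Matrix.PosDef.conjTranspose_mul_mul_same (B := C) hX
    (Matrix.mulVec_injective_of_isUnit hC)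
  rwa [Matrix.conjTranspose_eq_transpose_of_trivial] at h

/-- The metric at `BᵀB` is the Frobenius inner product after the congruence by `B⁻¹`. -/
theorem metric_eq_sum {X U V : SymMat n} {B : Matrix (Fin n) (Fin n) ℝ}
    (hX : (X : Matrix (Fin n) (Fin n) ℝ) = Bᵀ * B) :
    metric X U V = ∑ i, ∑ j, (B⁻¹ᵀ * (U : Matrix (Fin n) (Fin n) ℝ) * B⁻¹) i j *
      (B⁻¹ᵀ * (V : Matrix (Fin n) (Fin n) ℝ) * B⁻¹) i j := by
  have hinv : (X : Matrix (Fin n) (Fin n) ℝ)⁻¹ = B⁻¹ * B⁻¹ᵀ := by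
    rw [hX, Matrix.mul_inv_rev, Matrix.transpose_nonsing_inv]
  have hs : (B⁻¹ᵀ * (V : Matrix (Fin n) (Fin n) ℝ) * B⁻¹)ᵀ =
      B⁻¹ᵀ * (V : Matrix (Fin n) (Fin n) ℝ) * B⁻¹ := by
    simp only [Matrix.transpose_mul, Matrix.transpose_transpose, isSymm_coe, Matrix.mul_assoc]
  have ht : metric X U V = Matrix.trace ((B⁻¹ᵀ * (U : Matrix (Fin n) (Fin n) ℝ) * B⁻¹) *
      (B⁻¹ᵀ * (V : Matrix (Fin n) (Fin n) ℝ) * B⁻¹)ᵀ) := by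
    rw [hs, metric, hinv, Matrix.trace_mul_comm (B⁻¹ᵀ * _ * _), ← Matrix.mul_assoc,
      Matrix.trace_mul_comm (_ * _) B⁻¹ᵀ]
    congr 1
    simp only [Matrix.mul_assoc]
  rw [ht, Matrix.trace]
  simp only [Matrix.diag_apply, Matrix.mul_apply (N := (_)ᵀ), Matrix.transpose_apply]

theorem metric_self_nonneg {X : SymMat n} (hX : X ∈ posDef n) (U : SymMat n) :
    0 ≤ metric X U U := by
  obtain ⟨B, -, hXB⟩ := exists_eq_transpose_mul_self hX
  rw [metric_eq_sum hXB]
  exact Finset.sum_nonneg fun i _ => Finset.sum_nonneg fun j _ => mul_self_nonneg _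

theorem eq_zero_of_metric_self_eq_zero {X : SymMat n} (hX : X ∈ posDef n) {U : SymMat n}
    (h : metric X U U = 0) : U = 0 := by
  obtain ⟨B, hB, hXB⟩ := exists_eq_transpose_mul_self hX
  rw [metric_eq_sum hXB] at h
  have h' := (Finset.sum_eq_zero_iff_of_nonneg
    fun i _ => Finset.sum_nonneg fun j _ => mul_self_nonneg _).1 h
  have h0 : B⁻¹ᵀ * (U : Matrix (Fin n) (Fin n) ℝ) * B⁻¹ = 0 := by
    ext i j
    exact mul_self_eq_zero.1 ((Finset.sum_eq_zero_iff_of_nonneg fun j _ => mul_self_nonneg _).1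
      (h' i (Finset.mem_univ i)) j (Finset.mem_univ j))
  have hdet := (Matrix.isUnit_iff_isUnit_det B).1 hB
  have h1 : Bᵀ * (B⁻¹ᵀ * (U : Matrix (Fin n) (Fin n) ℝ) * B⁻¹) * B = U := by
    rw [Matrix.mul_assoc B⁻¹ᵀ, ← Matrix.mul_assoc Bᵀ, ← Matrix.transpose_mul,
      Matrix.nonsing_inv_mul B hdet, Matrix.transpose_one, Matrix.one_mul, Matrix.mul_assoc,
      Matrix.nonsing_inv_mul B hdet, Matrix.mul_one]
  ext1
  rw [← h1, h0]; simp

theorem metric_comm (X U V : SymMat n) : metric X U V = metric X V U := by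
  rw [metric, metric, Matrix.mul_assoc (_ * _), Matrix.trace_mul_comm, ← Matrix.mul_assoc]

/-- The metric as a bilinear form on the tangent space. -/
noncomputable def metricForm (X : SymMat n) : SymMat n →ₗ[ℝ] SymMat n →ₗ[ℝ] ℝ :=
  LinearMap.mk₂ ℝ (metric X)
    (fun U U' V => by simp [metric, Matrix.mul_add, Matrix.add_mul])
    (fun c U V => by simp [metric])
    (fun U V V' => by simp [metric, Matrix.add_mul])
    (fun c U V => by simp [metric])

@[simp]
theorem metricForm_apply (X U V : SymMat n) : metricForm X U V = metric X U V := rfl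

/-- Definiteness gives injectivity into the dual, and equal dimensions give surjectivity. This
serves both the gradient and the separating functional of Hahn–Banach. -/
theorem exists_metric_eq {X : SymMat n} (hX : X ∈ posDef n) (φ : SymMat n →ₗ[ℝ] ℝ) :
    ∃ G : SymMat n, ∀ V, metric X G V = φ V := by
  have hinj : Function.Injective (metricForm X) := by
    rw [← LinearMap.ker_eq_bot, LinearMap.ker_eq_bot']
    intro U hU
    exact eq_zero_of_metric_self_eq_zero hX (by simpa using LinearMap.congr_fun hU U)
  have hsurj := (LinearMap.injective_iff_surjective_of_finrank_eq_finrank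
    (Subspace.dual_finrank_eq (K := ℝ) (V := SymMat n)).symm).1 hinj
  obtain ⟨G, hG⟩ := hsurj φ
  exact ⟨G, fun V => LinearMap.congr_fun hG V⟩

theorem metric_riemGrad {X : SymMat n} (hX : X ∈ posDef n) (f : SymMat n → ℝ) (V : SymMat n) :
    metric X (riemGrad f X) V = fderiv ℝ f X V := by
  have h : ∃ G : SymMat n, ∀ V : SymMat n, metric X G V = fderiv ℝ f X V :=
    exists_metric_eq hX (fderiv ℝ f X).toLinearMap
  exact Classical.epsilon_spec h V

end SPD

/-! ### Geodesics and the exponential map -/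

section

attribute [local instance] Matrix.frobeniusNormedRing Matrix.frobeniusNormedAlgebra

namespace SPD

open NormedSpace Matrix

variable {n : ℕ}

/-- The transpose of `X⁻¹ V` is its conjugate by `X`, and `exp` commutes with conjugation. -/
theorem transpose_exp_mul {X : SymMat n} (hX : X ∈ posDef n) (V : SymMat n) :
    (exp ((X : Matrix (Fin n) (Fin n) ℝ)⁻¹ * (V : Matrix (Fin n) (Fin n) ℝ)))ᵀ *
      (X : Matrix (Fin n) (Fin n) ℝ) = X * exp ((X : Matrix (Fin n) (Fin n) ℝ)⁻¹ * V) := by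
  have hu := isUnit_of_mem_posDef hX
  have hd := (Matrix.isUnit_iff_isUnit_det _).1 hu
  have h1 : ((X : Matrix (Fin n) (Fin n) ℝ)⁻¹ * (V : Matrix (Fin n) (Fin n) ℝ))ᵀ =
      X * ((X : Matrix (Fin n) (Fin n) ℝ)⁻¹ * V) * (X : Matrix (Fin n) (Fin n) ℝ)⁻¹ := by
    rw [Matrix.transpose_mul, Matrix.transpose_nonsing_inv, isSymm_coe, isSymm_coe,
      ← Matrix.mul_assoc _ _ (V : Matrix (Fin n) (Fin n) ℝ), Matrix.mul_nonsing_inv _ hd,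
      Matrix.one_mul]
  rw [← Matrix.exp_transpose, h1, Matrix.exp_conj _ _ hu, Matrix.mul_assoc,
    Matrix.nonsing_inv_mul _ hd, Matrix.mul_one]

theorem isSymm_mul_exp {X : SymMat n} (hX : X ∈ posDef n) (V : SymMat n) :
    ((X : Matrix (Fin n) (Fin n) ℝ) *
      exp ((X : Matrix (Fin n) (Fin n) ℝ)⁻¹ * (V : Matrix (Fin n) (Fin n) ℝ))).IsSymm := by
  rw [Matrix.IsSymm, Matrix.transpose_mul, isSymm_coe, transpose_exp_mul hX]

theorem posDef_mul_exp {X : SymMat n} (hX : X ∈ posDef n) (V : SymMat n) :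
    ((X : Matrix (Fin n) (Fin n) ℝ) *
      exp ((X : Matrix (Fin n) (Fin n) ℝ)⁻¹ * (V : Matrix (Fin n) (Fin n) ℝ))).PosDef := by
  -- Halving `V` exhibits the matrix as the congruence `(exp A)ᵀ X (exp A)`.
  set A := (X : Matrix (Fin n) (Fin n) ℝ)⁻¹ * (((1 / 2 : ℝ) • V : SymMat n) :
    Matrix (Fin n) (Fin n) ℝ) with hA
  have h2 : (X : Matrix (Fin n) (Fin n) ℝ)⁻¹ * (V : Matrix (Fin n) (Fin n) ℝ) = A + A := by
    rw [hA, ← Matrix.mul_add, Submodule.coe_smul, ← add_smul]; norm_num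
  have h3 : exp (A + A) = exp A * exp A := Matrix.exp_add_of_commute A A (Commute.refl A)
  have h4 := transpose_exp_mul hX ((1 / 2 : ℝ) • V)
  rw [h2, h3, ← Matrix.mul_assoc, ← h4]
  exact posDef_transpose_mul_mul hX (Matrix.isUnit_exp A)

/-- Each of the three derivatives is minus a sum of two traces; as two arguments agree, all six
traces coincide by cyclicity. -/
theorem christoffel_self {X : SymMat n} (hX : X ∈ posDef n) (U W : SymMat n) :
    christoffel X U U W = -Matrix.trace ((W : Matrix (Fin n) (Fin n) ℝ) *
      (X : Matrix (Fin n) (Fin n) ℝ)⁻¹ * (U : Matrix (Fin n) (Fin n) ℝ) *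
      (X : Matrix (Fin n) (Fin n) ℝ)⁻¹ * (U : Matrix (Fin n) (Fin n) ℝ) *
      (X : Matrix (Fin n) (Fin n) ℝ)⁻¹) := by
  have key : ∀ V W U : SymMat n, fderiv ℝ (fun Y => metric Y V W) X U =
      -Matrix.trace ((W : Matrix (Fin n) (Fin n) ℝ) * (X : Matrix (Fin n) (Fin n) ℝ)⁻¹ *
        (U : Matrix (Fin n) (Fin n) ℝ) * (X : Matrix (Fin n) (Fin n) ℝ)⁻¹ *
        (V : Matrix (Fin n) (Fin n) ℝ) * (X : Matrix (Fin n) (Fin n) ℝ)⁻¹) -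
      Matrix.trace ((W : Matrix (Fin n) (Fin n) ℝ) * (X : Matrix (Fin n) (Fin n) ℝ)⁻¹ *
        (V : Matrix (Fin n) (Fin n) ℝ) * (X : Matrix (Fin n) (Fin n) ℝ)⁻¹ *
        (U : Matrix (Fin n) (Fin n) ℝ) * (X : Matrix (Fin n) (Fin n) ℝ)⁻¹) := by
    intro V W U
    obtain ⟨K, hK, hK'⟩ := exists_hasFDerivAt_inverse_quadratic
      (LinearMap.toContinuousLinearMap (Matrix.traceLinearMap (Fin n) ℝ ℝ))
      (V : Matrix (Fin n) (Fin n) ℝ) (W : Matrix (Fin n) (Fin n) ℝ) (isUnit_of_mem_posDef hX)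
    have h1 : HasFDerivAt (fun Y : SymMat n => metric Y V W) (K.comp (incl n)) X := by
      have := HasFDerivAt.comp X (f := incl n) hK (incl n).hasFDerivAt
      have he : (fun Y : SymMat n => metric Y V W) = fun Y : SymMat n =>
          Matrix.trace ((W : Matrix (Fin n) (Fin n) ℝ) * Ring.inverse (Y : Matrix (Fin n) (Fin n) ℝ) *
            (V : Matrix (Fin n) (Fin n) ℝ) * Ring.inverse (Y : Matrix (Fin n) (Fin n) ℝ)) := by
        funext Y
        simp only [metric, Matrix.nonsing_inv_eq_ringInverse]
      rw [he]
      exact this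
    rw [h1.fderiv]
    simp only [Matrix.nonsing_inv_eq_ringInverse]
    exact hK' U
  rw [christoffel, key, key, key]
  have hc : Matrix.trace ((U : Matrix (Fin n) (Fin n) ℝ) * (X : Matrix (Fin n) (Fin n) ℝ)⁻¹ *
      (U : Matrix (Fin n) (Fin n) ℝ) * (X : Matrix (Fin n) (Fin n) ℝ)⁻¹ *
      (W : Matrix (Fin n) (Fin n) ℝ) * (X : Matrix (Fin n) (Fin n) ℝ)⁻¹) =
      Matrix.trace ((W : Matrix (Fin n) (Fin n) ℝ) *
      (X : Matrix (Fin n) (Fin n) ℝ)⁻¹ * (U : Matrix (Fin n) (Fin n) ℝ) *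
      (X : Matrix (Fin n) (Fin n) ℝ)⁻¹ * (U : Matrix (Fin n) (Fin n) ℝ) *
      (X : Matrix (Fin n) (Fin n) ℝ)⁻¹) := by
    rw [Matrix.mul_assoc (_ * _ * _ * _) (W : Matrix (Fin n) (Fin n) ℝ), Matrix.trace_mul_comm]
    simp only [Matrix.mul_assoc]
  have hc' : Matrix.trace ((U : Matrix (Fin n) (Fin n) ℝ) * (X : Matrix (Fin n) (Fin n) ℝ)⁻¹ *
      (W : Matrix (Fin n) (Fin n) ℝ) * (X : Matrix (Fin n) (Fin n) ℝ)⁻¹ *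
      (U : Matrix (Fin n) (Fin n) ℝ) * (X : Matrix (Fin n) (Fin n) ℝ)⁻¹) =
      Matrix.trace ((W : Matrix (Fin n) (Fin n) ℝ) *
      (X : Matrix (Fin n) (Fin n) ℝ)⁻¹ * (U : Matrix (Fin n) (Fin n) ℝ) *
      (X : Matrix (Fin n) (Fin n) ℝ)⁻¹ * (U : Matrix (Fin n) (Fin n) ℝ) *
      (X : Matrix (Fin n) (Fin n) ℝ)⁻¹) := by
    rw [Matrix.mul_assoc _ _ (W : Matrix (Fin n) (Fin n) ℝ)]
    simp only [← Matrix.mul_assoc]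
    rw [Matrix.mul_assoc (_ * _), Matrix.mul_assoc (_ * _), Matrix.mul_assoc (_ * _),
      Matrix.trace_mul_comm]
    simp only [Matrix.mul_assoc]
  rw [hc, hc']
  ring

/-- The geodesic equation in matrix form. -/
theorem geodesic_equation_iff {X : SymMat n} (hX : X ∈ posDef n) (U A : SymMat n) :
    (∀ W : SymMat n, metric X A W + christoffel X U U W = 0) ↔
      (A : Matrix (Fin n) (Fin n) ℝ) = (U : Matrix (Fin n) (Fin n) ℝ) *
        (X : Matrix (Fin n) (Fin n) ℝ)⁻¹ * (U : Matrix (Fin n) (Fin n) ℝ) := by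
  have hs : ((U : Matrix (Fin n) (Fin n) ℝ) *
        (X : Matrix (Fin n) (Fin n) ℝ)⁻¹ * (U : Matrix (Fin n) (Fin n) ℝ)).IsSymm := by
    simp only [Matrix.IsSymm, Matrix.transpose_mul, Matrix.transpose_nonsing_inv, isSymm_coe,
      Matrix.mul_assoc]
  set C : SymMat n := ⟨_, hs⟩ with hC
  have h1 : ∀ W, christoffel X U U W = -metric X C W := by
    intro W
    rw [christoffel_self hX, metric]
    simp only [hC, Matrix.mul_assoc]
  have h2 : (∀ W : SymMat n, metric X A W + christoffel X U U W = 0) ↔ A = C := by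
    refine ⟨fun h => ?_, fun h W => by rw [h, h1, add_neg_cancel]⟩
    have h3 := h (A - C)
    rw [h1] at h3
    refine sub_eq_zero.1 (eq_zero_of_metric_self_eq_zero hX ?_)
    rw [metric_comm, ← metricForm_apply, map_sub, metricForm_apply, metricForm_apply, metric_comm X _ A,
      metric_comm X _ C]
    linarith
  rw [h2, Subtype.ext_iff]

theorem contDiff_exp_matrix : ContDiff ℝ ∞ (exp : Matrix (Fin n) (Fin n) ℝ → _) :=
  AnalyticOnNhd.contDiff fun x _ => NormedSpace.exp_analytic x

theorem exists_isGeodesic {X : SymMat n} (hX : X ∈ posDef n) (V : SymMat n) :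
    ∃ γ : ℝ → SymMat n, IsGeodesic γ ∧ γ 0 = X ∧ deriv γ 0 = V := by
  have hu := isUnit_of_mem_posDef hX
  set c := (X : Matrix (Fin n) (Fin n) ℝ)⁻¹ * (V : Matrix (Fin n) (Fin n) ℝ) with hc
  set G : ℝ → Matrix (Fin n) (Fin n) ℝ := fun t => X * exp (t • c) with hG
  have hXc : X * c = V := by
    rw [hc, ← Matrix.mul_assoc, Matrix.mul_nonsing_inv _ ((Matrix.isUnit_iff_isUnit_det _).1 hu),
      Matrix.one_mul]
  have htc : ∀ t : ℝ, t • c = (X : Matrix (Fin n) (Fin n) ℝ)⁻¹ * (t • V : SymMat n) := by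
    intro t; rw [hc, Submodule.coe_smul, Matrix.mul_smul]
  have hpos : ∀ t, (G t).PosDef := fun t => by rw [hG]; simp only [htc]; exact posDef_mul_exp hX _
  have hsym : ∀ t, (G t).IsSymm := fun t => by rw [hG]; simp only [htc]; exact isSymm_mul_exp hX _
  have hd : ∀ t, HasDerivAt G (G t * c) t := fun t => hasDerivAt_const_mul_exp _ _ _
  have hd' : ∀ t, HasDerivAt (fun t => G t * c) (G t * c * c) t := fun t => (hd t).mul_const c
  have hG_smooth : ContDiff ℝ ∞ G :=
    contDiff_const.mul (contDiff_exp_matrix.comp (contDiff_id.smul contDiff_const))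
  -- `G` is already symmetric; composing with the linear map `symPart` moves it to the subtype while
  -- keeping smoothness and derivatives.
  set γ : ℝ → SymMat n := fun t => symPart n (G t) with hγ
  have hcoe : ∀ t, (γ t : Matrix (Fin n) (Fin n) ℝ) = G t := fun t => coe_symPart (hsym t)
  have hγd : ∀ t, HasDerivAt γ (symPart n (G t * c)) t := fun t =>
    (symPart n).hasFDerivAt.comp_hasDerivAt t (hd t)
  have hγd' : ∀ t, HasDerivAt (fun t => symPart n (G t * c)) (symPart n (G t * c * c)) t := fun t =>
    (symPart n).hasFDerivAt.comp_hasDerivAt t (hd' t)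
  have hderiv : deriv γ = fun t => symPart n (G t * c) := funext fun t => (hγd t).deriv
  -- Uniqueness of derivatives replaces a direct check that `G t * c` is symmetric.
  have hc1 : ∀ t, (symPart n (G t * c) : Matrix (Fin n) (Fin n) ℝ) = G t * c := fun t =>
    (((incl n).hasFDerivAt.comp_hasDerivAt t (hγd t)).congr_of_eventuallyEq
      (.of_forall fun s => (hcoe s).symm)).unique (hd t)
  have hc2 : ∀ t, (symPart n (G t * c * c) : Matrix (Fin n) (Fin n) ℝ) = G t * c * c := fun t =>
    (((incl n).hasFDerivAt.comp_hasDerivAt t (hγd' t)).congr_of_eventuallyEq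
      (.of_forall fun s => (hc1 s).symm)).unique (hd' t)
  have hG0 : G 0 = X := by
    simp only [hG, zero_smul, NormedSpace.exp_zero, Matrix.mul_one]
  have hγpos : ∀ t, γ t ∈ posDef n := fun t => by
    change (γ t : Matrix (Fin n) (Fin n) ℝ).PosDef
    rw [hcoe]; exact hpos t
  refine ⟨γ, ⟨(symPart n).contDiff.comp hG_smooth, hγpos, fun t => ?_⟩, ?_, ?_⟩
  · refine (geodesic_equation_iff (hγpos t) _ _).2 ?_
    have hdd : deriv (deriv γ) t = symPart n (G t * c * c) := by rw [hderiv]; exact (hγd' t).deriv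
    rw [hdd, congrFun hderiv t, hc2, hc1, hcoe, Matrix.mul_assoc (G t * c) (G t)⁻¹,
      ← Matrix.mul_assoc (G t)⁻¹,
      Matrix.nonsing_inv_mul _ ((Matrix.isUnit_iff_isUnit_det _).1 (hpos t).isUnit), Matrix.one_mul,
      Matrix.mul_assoc]
  · rw [hγ]; simp only [hG0, symPart_coe]
  · rw [hderiv]; simp only [hG0, hXc, symPart_coe]

theorem eq_mul_exp_of_isGeodesic {γ : ℝ → SymMat n} (hγ : IsGeodesic γ) (t : ℝ) :
    (γ t : Matrix (Fin n) (Fin n) ℝ) = (γ 0 : Matrix (Fin n) (Fin n) ℝ) *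
      exp (t • ((γ 0 : Matrix (Fin n) (Fin n) ℝ)⁻¹ * (deriv γ 0 : SymMat n))) := by
  obtain ⟨hs, hpos, hgeo⟩ := hγ
  have hs' : ContDiff ℝ ∞ (deriv γ) := (contDiff_infty_iff_deriv.1 hs).2
  have hd : ∀ t, HasDerivAt (fun t => (γ t : Matrix (Fin n) (Fin n) ℝ)) (deriv γ t : SymMat n) t :=
    fun t => (incl n).hasFDerivAt.comp_hasDerivAt t
      (hs.differentiable (by simp) t).hasDerivAt
  have hd' : ∀ t, HasDerivAt (fun t => ((deriv γ t : SymMat n) : Matrix (Fin n) (Fin n) ℝ))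
      (deriv (deriv γ) t : SymMat n) t :=
    fun t => (incl n).hasFDerivAt.comp_hasDerivAt t
      (hs'.differentiable (by simp) t).hasDerivAt
  have hu := fun t => isUnit_of_mem_posDef (hpos t)
  rw [Matrix.nonsing_inv_eq_ringInverse]
  refine eq_mul_exp_of_geodesic_equation hu hd (fun t => ?_) t
  have h := (geodesic_equation_iff (hpos t) _ _).1 (hgeo t)
  rw [Matrix.nonsing_inv_eq_ringInverse] at h
  have h' := hd' t
  rw [h] at h'
  exact h'

/-- Existence of a geodesic rules out the default branch, and the explicit formula makes the choice
of geodesic immaterial. -/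
theorem coe_expMap {X : SymMat n} (hX : X ∈ posDef n) (V : SymMat n) :
    (expMap X V : Matrix (Fin n) (Fin n) ℝ) = (X : Matrix (Fin n) (Fin n) ℝ) *
      exp ((X : Matrix (Fin n) (Fin n) ℝ)⁻¹ * (V : Matrix (Fin n) (Fin n) ℝ)) := by
  have h := exists_isGeodesic hX V
  rw [expMap, dif_pos h, eq_mul_exp_of_isGeodesic h.choose_spec.1, h.choose_spec.2.1,
    h.choose_spec.2.2, one_smul]

theorem expMap_eq_symPart {X : SymMat n} (hX : X ∈ posDef n) (V : SymMat n) :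
    expMap X V = symPart n ((X : Matrix (Fin n) (Fin n) ℝ) *
      exp ((X : Matrix (Fin n) (Fin n) ℝ)⁻¹ * (V : Matrix (Fin n) (Fin n) ℝ))) := by
  rw [← coe_expMap hX, symPart_coe]

end SPD

end

/-! ### The inverse exponential map and the Clarke difference quotient -/

section

attribute [local instance] Matrix.frobeniusNormedRing Matrix.frobeniusNormedAlgebra

namespace SPD

open NormedSpace Matrix

variable {n : ℕ}

theorem exp_injective_of_isHermitian {A B : Matrix (Fin n) (Fin n) ℝ} (hA : A.IsHermitian)
    (hB : B.IsHermitian) (h : exp A = exp B) : A = B := by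
  have h1 := @CFC.log_exp _ _ _ _ Matrix.IsHermitian.instContinuousFunctionalCalculus A hA
  have h2 := @CFC.log_exp _ _ _ _ Matrix.IsHermitian.instContinuousFunctionalCalculus B hB
  exact (h1.symm.trans (congrArg _ h)).trans h2

/-- With `X = Bᵀ B`, the matrix `X⁻¹ V` is conjugate by `B` to the symmetric `B⁻¹ᵀ V B⁻¹`, and `exp`
is injective on symmetric matrices. -/
theorem expMap_injective {X : SymMat n} (hX : X ∈ posDef n) : Function.Injective (expMap X) := by
  intro V W h
  obtain ⟨B, hB, hXB⟩ := exists_eq_transpose_mul_self hX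
  have hu := isUnit_of_mem_posDef hX
  have hdet := (Matrix.isUnit_iff_isUnit_det B).1 hB
  have h1 := congrArg (Subtype.val) h
  rw [coe_expMap hX, coe_expMap hX] at h1
  have h2 := hu.mul_left_cancel h1
  have hsplit : ∀ V : SymMat n, (X : Matrix (Fin n) (Fin n) ℝ)⁻¹ * (V : Matrix (Fin n) (Fin n) ℝ) =
      B⁻¹ * (B⁻¹ᵀ * (V : Matrix (Fin n) (Fin n) ℝ) * B⁻¹) * B := by
    intro V
    rw [hXB, Matrix.mul_inv_rev, Matrix.transpose_nonsing_inv, Matrix.mul_assoc,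
      Matrix.mul_assoc _ _ B, Matrix.mul_assoc _ _ B, Matrix.nonsing_inv_mul B hdet, Matrix.mul_one]
  have hherm : ∀ V : SymMat n,
      (B⁻¹ᵀ * (V : Matrix (Fin n) (Fin n) ℝ) * B⁻¹).IsHermitian := by
    intro V
    rw [Matrix.IsHermitian, Matrix.conjTranspose_eq_transpose_of_trivial]
    simp only [Matrix.transpose_mul, Matrix.transpose_transpose, isSymm_coe, Matrix.mul_assoc]
  rw [hsplit V, hsplit W, Matrix.exp_conj' _ _ hB, Matrix.exp_conj' _ _ hB] at h2
  have hBi : IsUnit B⁻¹ := Matrix.isUnit_nonsing_inv_iff.2 hB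
  have h3 := exp_injective_of_isHermitian (hherm V) (hherm W)
    (hBi.mul_left_cancel (hB.mul_right_cancel h2))
  have hBt : IsUnit B⁻¹ᵀ := (Matrix.isUnit_transpose _).2 hBi
  exact Subtype.ext (hBt.mul_left_cancel (hBi.mul_right_cancel h3))

theorem contDiff_expMap {X : SymMat n} (hX : X ∈ posDef n) : ContDiff ℝ ∞ (expMap X) := by
  rw [funext (expMap_eq_symPart hX)]
  exact (symPart n).contDiff.comp (contDiff_const.mul (contDiff_exp_matrix.comp
    (contDiff_const.mul (incl n).contDiff)))

theorem mul_inv_mul_coe {X : SymMat n} (hX : X ∈ posDef n) (V : Matrix (Fin n) (Fin n) ℝ) :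
    (X : Matrix (Fin n) (Fin n) ℝ) * ((X : Matrix (Fin n) (Fin n) ℝ)⁻¹ * V) = V := by
  rw [← Matrix.mul_assoc,
    Matrix.mul_nonsing_inv _ ((Matrix.isUnit_iff_isUnit_det _).1 (isUnit_of_mem_posDef hX)),
    Matrix.one_mul]

theorem expMap_zero {X : SymMat n} (hX : X ∈ posDef n) : expMap X 0 = X := by
  ext1
  rw [coe_expMap hX, Submodule.coe_zero, Matrix.mul_zero, NormedSpace.exp_zero, Matrix.mul_one]

theorem hasFDerivAt_expMap_zero {X : SymMat n} (hX : X ∈ posDef n) :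
    HasFDerivAt (expMap X) (ContinuousLinearMap.id ℝ (SymMat n)) 0 := by
  have hd : HasFDerivAt (expMap X) (fderiv ℝ (expMap X) 0) 0 :=
    ((contDiff_expMap hX).differentiable (by simp) 0).hasFDerivAt
  suffices heq : fderiv ℝ (expMap X) 0 = ContinuousLinearMap.id ℝ (SymMat n) by
    rw [heq] at hd
    exact hd
  ext1 V
  have hline : HasDerivAt (fun t : ℝ => t • V) V 0 := by
    have := (hasDerivAt_id (0 : ℝ)).smul_const V
    rw [one_smul] at this
    exact this
  have h0 : HasFDerivAt (expMap X) (fderiv ℝ (expMap X) 0) ((0 : ℝ) • V) := by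
    rwa [zero_smul]
  have h1 := h0.comp_hasDerivAt (0 : ℝ) hline
  have h2 : HasDerivAt (fun t : ℝ => symPart n ((X : Matrix (Fin n) (Fin n) ℝ) *
      exp (t • ((X : Matrix (Fin n) (Fin n) ℝ)⁻¹ * (V : Matrix (Fin n) (Fin n) ℝ))))) V 0 := by
    have h := hasDerivAt_const_mul_exp (X : Matrix (Fin n) (Fin n) ℝ)
      ((X : Matrix (Fin n) (Fin n) ℝ)⁻¹ * (V : Matrix (Fin n) (Fin n) ℝ)) 0
    rw [zero_smul, NormedSpace.exp_zero, Matrix.mul_one, mul_inv_mul_coe hX] at h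
    have h' : HasDerivAt (fun t : ℝ => symPart n ((X : Matrix (Fin n) (Fin n) ℝ) *
        exp (t • ((X : Matrix (Fin n) (Fin n) ℝ)⁻¹ * (V : Matrix (Fin n) (Fin n) ℝ)))))
        (symPart n (V : Matrix (Fin n) (Fin n) ℝ)) 0 :=
      (symPart n).hasFDerivAt.comp_hasDerivAt (0 : ℝ) h
    rw [symPart_coe] at h'
    exact h'
  have h3 : (expMap X ∘ fun t : ℝ => t • V) = fun t : ℝ => symPart n
      ((X : Matrix (Fin n) (Fin n) ℝ) *
      exp (t • ((X : Matrix (Fin n) (Fin n) ℝ)⁻¹ * (V : Matrix (Fin n) (Fin n) ℝ)))) := by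
    funext t
    rw [Function.comp_apply, expMap_eq_symPart hX, Submodule.coe_smul, Matrix.mul_smul]
  rw [h3] at h1
  exact h1.unique h2

/-- The inverse function theorem says that `expMap X` maps `𝓝 0` onto `𝓝 X`; global injectivity
makes `invFun` a left inverse, so the limit can be taken upstairs. -/
theorem tendsto_expInv {X : SymMat n} (hX : X ∈ posDef n) :
    Tendsto (expInv X) (𝓝 X) (𝓝 0) := by
  have hs : HasStrictFDerivAt (expMap X)
      ((ContinuousLinearEquiv.refl ℝ (SymMat n) : SymMat n ≃L[ℝ] SymMat n) :
        SymMat n →L[ℝ] SymMat n) 0 :=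
    (contDiff_expMap hX).contDiffAt.hasStrictFDerivAt' (hasFDerivAt_expMap_zero hX) (by simp)
  have hmap : map (expMap X) (𝓝 0) = 𝓝 (expMap X 0) := hs.map_nhds_eq_of_equiv
  rw [expMap_zero hX] at hmap
  rw [← hmap, tendsto_map'_iff]
  have : expInv X ∘ expMap X = id :=
    funext fun V => Function.leftInverse_invFun (expMap_injective hX) V
  rw [this]
  exact tendsto_id

theorem tendsto_fderiv_expMap {X : SymMat n} (hX : X ∈ posDef n) (V : SymMat n) :
    Tendsto (fun Y => fderiv ℝ (expMap X) (expInv X Y) V) (𝓝 X) (𝓝 V) := by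
  have hf : fderiv ℝ (expMap X) 0 = ContinuousLinearMap.id ℝ (SymMat n) :=
    (hasFDerivAt_expMap_zero hX).fderiv
  have hc : Tendsto (fun W => fderiv ℝ (expMap X) W V) (𝓝 0) (𝓝 (fderiv ℝ (expMap X) 0 V)) :=
    (((contDiff_expMap hX).continuous_fderiv (by simp)).clm_apply
      (continuous_const (y := V))).tendsto 0
  rw [hf] at hc
  exact hc.comp (tendsto_expInv hX)

theorem tendsto_coe_inv {X : SymMat n} (hX : X ∈ posDef n) :
    Tendsto (fun Y : SymMat n => (Y : Matrix (Fin n) (Fin n) ℝ)⁻¹) (𝓝 X)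
      (𝓝 (X : Matrix (Fin n) (Fin n) ℝ)⁻¹) := by
  simp only [Matrix.nonsing_inv_eq_ringInverse]
  obtain ⟨u, hu⟩ := isUnit_of_mem_posDef hX
  have h := (hasFDerivAt_ringInverse (𝕜 := ℝ) u).continuousAt
  rw [hu] at h
  exact h.tendsto.comp ((incl n).continuous.tendsto X)

/-- The point at which `f` is evaluated in the difference quotient of the Clarke derivative. -/
noncomputable def clarkePoint (X V : SymMat n) (z : ℝ × SymMat n) : SymMat n :=
  expMap z.2 (z.1 • fderiv ℝ (expMap X) (expInv X z.2) V)

/-- The quotient is `Y (exp (t b) - 1) / t` with `b = Y⁻¹ W`, where `W → V` is the transported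
vector; it tends to `X X⁻¹ V`. -/
theorem tendsto_inv_smul_clarkePoint_sub {X : SymMat n} (hX : X ∈ posDef n) (V : SymMat n) :
    Tendsto (fun z : ℝ × SymMat n => z.1⁻¹ • (clarkePoint X V z - z.2))
      (𝓝[>] (0 : ℝ) ×ˢ 𝓝[posDef n] X) (𝓝 V) := by
  set l := 𝓝[>] (0 : ℝ) ×ˢ 𝓝[posDef n] X with hl
  have h1 : Tendsto (fun z : ℝ × SymMat n => z.1) l (𝓝[>] 0) := tendsto_fst
  have h2' : Tendsto (fun z : ℝ × SymMat n => z.2) l (𝓝[posDef n] X) := tendsto_snd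
  have h2 : Tendsto (fun z : ℝ × SymMat n => z.2) l (𝓝 X) := h2'.mono_right nhdsWithin_le_nhds
  have hpos : ∀ᶠ z : ℝ × SymMat n in l, 0 < z.1 := h1.eventually self_mem_nhdsWithin
  have hmem : ∀ᶠ z : ℝ × SymMat n in l, z.2 ∈ posDef n := h2'.eventually self_mem_nhdsWithin
  have hV : Tendsto (fun z : ℝ × SymMat n => ((fderiv ℝ (expMap X) (expInv X z.2) V : SymMat n) :
      Matrix (Fin n) (Fin n) ℝ)) l (𝓝 (V : Matrix (Fin n) (Fin n) ℝ)) :=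
    ((incl n).continuous.tendsto V).comp ((tendsto_fderiv_expMap hX V).comp h2)
  have hB : Tendsto (fun z : ℝ × SymMat n => (z.2 : Matrix (Fin n) (Fin n) ℝ)⁻¹ *
      ((fderiv ℝ (expMap X) (expInv X z.2) V : SymMat n) : Matrix (Fin n) (Fin n) ℝ)) l
      (𝓝 ((X : Matrix (Fin n) (Fin n) ℝ)⁻¹ * (V : Matrix (Fin n) (Fin n) ℝ))) :=
    ((tendsto_coe_inv hX).comp h2).mul hV
  have hE := tendsto_inv_smul_exp_smul_sub_one (s := fun z : ℝ × SymMat n => z.1)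
    (h1.mono_right nhdsWithin_le_nhds) (hpos.mono fun z hz => hz.ne') hB
  have hY : Tendsto (fun z : ℝ × SymMat n => (z.2 : Matrix (Fin n) (Fin n) ℝ)) l
      (𝓝 (X : Matrix (Fin n) (Fin n) ℝ)) := ((incl n).continuous.tendsto X).comp h2
  have hlim := ((symPart n).continuous.tendsto _).comp (hY.mul hE)
  rw [mul_inv_mul_coe hX, symPart_coe] at hlim
  refine hlim.congr' (hmem.mono fun z hz => ?_)
  simp only [clarkePoint]
  rw [expMap_eq_symPart hz, Function.comp_apply, Submodule.coe_smul, Matrix.mul_smul]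
  rw [Matrix.mul_smul, Matrix.mul_sub, Matrix.mul_one, map_smul, map_sub, symPart_coe]
  rfl

theorem tendsto_clarkePoint {X : SymMat n} (hX : X ∈ posDef n) (V : SymMat n) :
    Tendsto (clarkePoint X V) (𝓝[>] (0 : ℝ) ×ˢ 𝓝[posDef n] X) (𝓝 X) := by
  set l := 𝓝[>] (0 : ℝ) ×ˢ 𝓝[posDef n] X with hl
  have h1 : Tendsto (fun z : ℝ × SymMat n => z.1) l (𝓝[>] 0) := tendsto_fst
  have h2 : Tendsto (fun z : ℝ × SymMat n => z.2) l (𝓝 X) :=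
    tendsto_snd.mono_right nhdsWithin_le_nhds
  have h3 := ((h1.mono_right nhdsWithin_le_nhds).smul
    (tendsto_inv_smul_clarkePoint_sub hX V)).add h2
  rw [zero_smul, zero_add] at h3
  refine h3.congr' ((h1.eventually self_mem_nhdsWithin).mono fun z hz => ?_)
  have hz' : z.1 ≠ 0 := (show 0 < z.1 from hz).ne'
  simp only [smul_smul, mul_inv_cancel₀ hz', one_smul, sub_add_cancel]

end SPD

end

/-! ### The Clarke subdifferential of a maximum -/

namespace SPD

variable {n : ℕ} {ι : Type*} [Fintype ι] [Nonempty ι] {F : ι → SymMat n → ℝ}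

theorem le_maxFun (F : ι → SymMat n → ℝ) (i : ι) (X : SymMat n) : F i X ≤ maxFun F X :=
  Finset.le_sup' (fun i => F i X) (Finset.mem_univ i)

theorem exists_eq_maxFun (F : ι → SymMat n → ℝ) (X : SymMat n) : ∃ i, F i X = maxFun F X := by
  obtain ⟨i, -, hi⟩ := Finset.exists_mem_eq_sup' Finset.univ_nonempty fun i => F i X
  exact ⟨i, hi.symm⟩

theorem tendsto_clarkeQuotient {X : SymMat n} (hX : X ∈ posDef n) {f : SymMat n → ℝ}
    (hf : ContDiffAt ℝ 1 f X) (V : SymMat n) :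
    Tendsto (fun z : ℝ × SymMat n => (f (clarkePoint X V z) - f z.2) / z.1)
      (𝓝[>] (0 : ℝ) ×ˢ 𝓝[posDef n] X) (𝓝 (fderiv ℝ f X V)) := by
  have h := tendsto_inv_smul_sub_of_hasStrictFDerivAt (hf.hasStrictFDerivAt (by simp))
    (tendsto_clarkePoint hX V) (tendsto_snd.mono_right nhdsWithin_le_nhds)
    (tendsto_inv_smul_clarkePoint_sub hX V)
  refine h.congr fun z => ?_
  rw [smul_eq_mul, div_eq_inv_mul]

theorem fderiv_le_clarkeDeriv {X : SymMat n} (hX : X ∈ posDef n) {i : ι}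
    (hF : ContDiffAt ℝ 1 (F i) X) (hi : F i X = maxFun F X) (V : SymMat n) :
    ((fderiv ℝ (F i) X V : ℝ) : EReal) ≤ clarkeDeriv (maxFun F) X V := by
  -- Freezing `Y = X` only lowers the upper limit, and there `F i` equals the maximum.
  have hle : 𝓝[>] (0 : ℝ) ×ˢ pure X ≤ 𝓝[>] (0 : ℝ) ×ˢ 𝓝[posDef n] X :=
    Filter.prod_mono le_rfl (pure_le_nhdsWithin hX)
  have h1 := (continuous_coe_real_ereal.tendsto _).comp
    ((tendsto_clarkeQuotient hX hF V).mono_left hle)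
  rw [← h1.limsup_eq]
  refine le_trans (limsup_le_limsup ?_) (limsup_le_limsup_of_le hle)
  have hpos : ∀ᶠ z : ℝ × SymMat n in 𝓝[>] (0 : ℝ) ×ˢ pure X, 0 < z.1 :=
    tendsto_fst.eventually self_mem_nhdsWithin
  have hX' : ∀ᶠ z : ℝ × SymMat n in 𝓝[>] (0 : ℝ) ×ˢ pure X, z.2 = X :=
    tendsto_snd.eventually (p := fun Y => Y = X) (Filter.eventually_pure.2 rfl)
  filter_upwards [hpos, hX'] with z hz hz'
  refine EReal.coe_le_coe_iff.2 (div_le_div_of_nonneg_right ?_ hz.le)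
  have hz2 : F i z.2 = maxFun F z.2 := by rw [hz', hi]
  rw [hz2]
  exact sub_le_sub_right (le_maxFun F i _) _

theorem clarkeDeriv_le {X : SymMat n} (hX : X ∈ posDef n) (hF : ∀ i, ContDiffAt ℝ 1 (F i) X)
    {V : SymMat n} {c : ℝ} (hc : ∀ i, F i X = maxFun F X → fderiv ℝ (F i) X V ≤ c) :
    clarkeDeriv (maxFun F) X V ≤ (c : EReal) := by
  refine EReal.le_of_forall_lt_iff_le.1 fun c' hc' => ?_
  have hc' : c < c' := EReal.coe_lt_coe_iff.1 hc'
  obtain ⟨i₀, hi₀⟩ := exists_eq_maxFun F X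
  have hcont : ∀ i, Tendsto (fun z => F i (clarkePoint X V z))
      (𝓝[>] (0 : ℝ) ×ˢ 𝓝[posDef n] X) (𝓝 (F i X)) := fun i =>
    (hF i).continuousAt.tendsto.comp (tendsto_clarkePoint hX V)
  have h1 : ∀ᶠ z in 𝓝[>] (0 : ℝ) ×ˢ 𝓝[posDef n] X, ∀ i, F i X = maxFun F X →
      (F i (clarkePoint X V z) - F i z.2) / z.1 < c' := by
    refine eventually_all.2 fun i => ?_
    by_cases hi : F i X = maxFun F X
    · exact ((tendsto_clarkeQuotient hX (hF i) V).eventually_lt_const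
        ((hc i hi).trans_lt hc')).mono fun z hz _ => hz
    · exact .of_forall fun z h => (hi h).elim
  have h2 : ∀ᶠ z in 𝓝[>] (0 : ℝ) ×ˢ 𝓝[posDef n] X, ∀ i, F i X ≠ maxFun F X →
      F i (clarkePoint X V z) < F i₀ (clarkePoint X V z) := by
    refine eventually_all.2 fun i => ?_
    by_cases hi : F i X = maxFun F X
    · exact .of_forall fun z h => (h hi).elim
    · exact ((hcont i).eventually_lt (hcont i₀)
        (hi₀ ▸ lt_of_le_of_ne (le_maxFun F i X) hi)).mono fun z hz _ => hz
  have hpos : ∀ᶠ z : ℝ × SymMat n in 𝓝[>] (0 : ℝ) ×ˢ 𝓝[posDef n] X, 0 < z.1 :=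
    tendsto_fst.eventually self_mem_nhdsWithin
  refine limsup_le_of_le (by isBoundedDefault) ?_
  filter_upwards [h1, h2, hpos] with z hz1 hz2 hz
  -- An index attaining the maximum at the moved point must be active at `X`, and its own quotient
  -- dominates that of the maximum.
  obtain ⟨j, hj⟩ := exists_eq_maxFun F (clarkePoint X V z)
  have hjX : F j X = maxFun F X := by
    by_contra hne
    exact absurd (hz2 j hne) (not_lt.2 (hj ▸ le_maxFun F i₀ _))
  refine EReal.coe_le_coe_iff.2 (le_trans ?_ (hz1 j hjX).le)
  refine div_le_div_of_nonneg_right ?_ hz.le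
  rw [hj]
  exact sub_le_sub_left (le_maxFun F j _) _

theorem convex_clarkeSubdiff (f : SymMat n → ℝ) (X : SymMat n) : Convex ℝ (clarkeSubdiff f X) := by
  intro W hW W' hW' a b ha hb hab V
  have h : metric X (a • W + b • W') V = a * metric X W V + b * metric X W' V := by
    simp only [← metricForm_apply, map_add, map_smul, LinearMap.add_apply, LinearMap.smul_apply,
      smul_eq_mul]
  -- The larger pairing dominates the convex combination, which avoids arithmetic in `EReal`.
  rcases le_total (metric X W V) (metric X W' V) with hle | hle
  · refine le_trans (EReal.coe_le_coe_iff.2 ?_) (hW' V)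
    have h1 := mul_le_mul_of_nonneg_left hle ha
    have h2 : a * metric X W' V + b * metric X W' V = metric X W' V := by
      rw [← add_mul, hab, one_mul]
    linarith
  · refine le_trans (EReal.coe_le_coe_iff.2 ?_) (hW V)
    have h1 := mul_le_mul_of_nonneg_left hle hb
    have h2 : a * metric X W V + b * metric X W V = metric X W V := by
      rw [← add_mul, hab, one_mul]
    linarith

theorem clarkeSubdiff_maxFun {X : SymMat n} (hX : X ∈ posDef n)
    (hF : ∀ i, ContDiffAt ℝ 1 (F i) X) :
    clarkeSubdiff (maxFun F) X =
      convexHull ℝ {G | ∃ i, F i X = maxFun F X ∧ G = riemGrad (F i) X} := by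
  refine Subset.antisymm (fun W hW => ?_) (convexHull_min ?_ (convex_clarkeSubdiff _ _))
  · by_contra hnot
    have hfin : {G | ∃ i, F i X = maxFun F X ∧ G = riemGrad (F i) X}.Finite :=
      (Set.finite_range fun i => riemGrad (F i) X).subset
        fun G ⟨i, _, hG⟩ => ⟨i, hG.symm⟩
    have : LocallyConvexSpace ℝ (SymMat n) := NormedSpace.toLocallyConvexSpace (E := SymMat n)
    obtain ⟨f, u, hf, hu⟩ := geometric_hahn_banach_closed_point (convex_convexHull ℝ _)
      (hfin.isClosed_convexHull ℝ) hnot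
    -- The separating functional becomes a direction `V` in which the Clarke derivative is too small
    -- for `W`.
    obtain ⟨V, hV⟩ := exists_metric_eq hX f.toLinearMap
    have hV' : ∀ G, metric X G V = f G := fun G => by rw [metric_comm]; exact hV G
    have h1 : clarkeDeriv (maxFun F) X V ≤ (u : EReal) := by
      refine clarkeDeriv_le hX hF fun i hi => ?_
      rw [← metric_riemGrad hX, hV']
      exact (hf _ (subset_convexHull ℝ _ ⟨i, hi, rfl⟩)).le
    have h2 := EReal.coe_le_coe_iff.1 ((hW V).trans h1)
    rw [hV'] at h2
    exact absurd hu (not_lt.2 h2)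
  · rintro G ⟨i, hi, rfl⟩ V
    rw [metric_riemGrad hX]
    exact fderiv_le_clarkeDeriv hX (hF i) hi V

end SPD

/-! ### The Riemannian distance against the Frobenius norm -/

namespace SPD

open Matrix MeasureTheory

variable {n : ℕ}

/-- The value at `v` of the quadratic form of a symmetric matrix, as a function of the matrix. -/
noncomputable def quadForm (v : Fin n → ℝ) : SymMat n →L[ℝ] ℝ :=
  LinearMap.toContinuousLinearMap
    { toFun := fun X => v ⬝ᵥ ((X : Matrix (Fin n) (Fin n) ℝ) *ᵥ v)
      map_add' := fun X Y => by simp [Matrix.add_mulVec, dotProduct_add]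
      map_smul' := fun c X => by simp [Matrix.smul_mulVec] }

theorem quadForm_apply (v : Fin n → ℝ) (X : SymMat n) :
    quadForm v X = v ⬝ᵥ ((X : Matrix (Fin n) (Fin n) ℝ) *ᵥ v) := rfl

theorem quadForm_pos {X : SymMat n} (hX : X ∈ posDef n) {v : Fin n → ℝ} (hv : v ≠ 0) :
    0 < quadForm v X := by
  have h := Matrix.PosDef.dotProduct_mulVec_pos hX hv
  rwa [star_trivial] at h

theorem quadForm_nonneg {X : SymMat n} (hX : X ∈ posDef n) (v : Fin n → ℝ) :
    0 ≤ quadForm v X := by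
  rcases eq_or_ne v 0 with rfl | hv
  · simp [quadForm_apply]
  · exact (quadForm_pos hX hv).le

/-- With `w = B v`, the left side pairs `S = B⁻¹ᵀ U B⁻¹` with `w wᵀ`, whose Frobenius norm is `|w|²
= vᵀ X v`; apply Cauchy–Schwarz. -/
theorem abs_quadForm_le {X : SymMat n} (hX : X ∈ posDef n) (U : SymMat n) (v : Fin n → ℝ) :
    |quadForm v U| ≤ Real.sqrt (metric X U U) * quadForm v X := by
  obtain ⟨B, hB, hXB⟩ := exists_eq_transpose_mul_self hX
  have hdet := (Matrix.isUnit_iff_isUnit_det B).1 hB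
  set S := B⁻¹ᵀ * (U : Matrix (Fin n) (Fin n) ℝ) * B⁻¹ with hS
  set w := B *ᵥ v with hw
  have hU : (U : Matrix (Fin n) (Fin n) ℝ) = Bᵀ * S * B := by
    rw [hS, Matrix.mul_assoc B⁻¹ᵀ, ← Matrix.mul_assoc Bᵀ, ← Matrix.transpose_mul,
      Matrix.nonsing_inv_mul B hdet, Matrix.transpose_one, Matrix.one_mul, Matrix.mul_assoc,
      Matrix.nonsing_inv_mul B hdet, Matrix.mul_one]
  have hq : ∀ T : Matrix (Fin n) (Fin n) ℝ, v ⬝ᵥ ((Bᵀ * T * B) *ᵥ v) = w ⬝ᵥ (T *ᵥ w) := by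
    intro T
    rw [Matrix.mul_assoc, ← Matrix.mulVec_mulVec, Matrix.dotProduct_mulVec, Matrix.vecMul_transpose,
      ← Matrix.mulVec_mulVec]
  have h1 : quadForm v U = ∑ p : Fin n × Fin n, S p.1 p.2 * (w p.1 * w p.2) := by
    rw [quadForm_apply, hU, hq, Fintype.sum_prod_type]
    simp only [dotProduct, Matrix.mulVec, Finset.mul_sum]
    exact Finset.sum_congr rfl fun i _ => Finset.sum_congr rfl fun j _ => by ring
  have h2 : quadForm v X = ∑ i, w i * w i := by
    have := hq 1
    rw [Matrix.mul_one, Matrix.one_mulVec, ← hXB] at this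
    exact this
  have h3 : metric X U U = ∑ p : Fin n × Fin n, S p.1 p.2 ^ 2 := by
    rw [metric_eq_sum hXB, Fintype.sum_prod_type]
    simp only [← hS, sq]
  have h4 : (quadForm v X) ^ 2 = ∑ p : Fin n × Fin n, (w p.1 * w p.2) ^ 2 := by
    rw [h2, sq, Finset.sum_mul_sum, Fintype.sum_prod_type]
    exact Finset.sum_congr rfl fun i _ => Finset.sum_congr rfl fun j _ => by ring
  have h5 : (quadForm v U) ^ 2 ≤ metric X U U * (quadForm v X) ^ 2 := by
    rw [h1, h3, h4]
    exact Finset.sum_mul_sq_le_sq_mul_sq _ _ _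
  calc |quadForm v U| ≤ Real.sqrt (metric X U U * (quadForm v X) ^ 2) := Real.abs_le_sqrt h5
    _ = Real.sqrt (metric X U U) * quadForm v X := by
      rw [Real.sqrt_mul (metric_self_nonneg hX U), Real.sqrt_sq (quadForm_nonneg hX v)]

/-- The speed of a curve. -/
noncomputable def speed (γ : ℝ → SymMat n) (t : ℝ) : ℝ :=
  Real.sqrt (metric (γ t) (deriv γ t) (deriv γ t))

theorem continuousOn_metric {s : Set ℝ} {γ U : ℝ → SymMat n} (hγ : ContinuousOn γ s)
    (hpos : ∀ t ∈ s, γ t ∈ posDef n) (hU : ContinuousOn U s) :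
    ContinuousOn (fun t => metric (γ t) (U t) (U t)) s := by
  intro t ht
  have h1 : Tendsto (fun t => (γ t : Matrix (Fin n) (Fin n) ℝ)⁻¹) (𝓝[s] t)
      (𝓝 (γ t : Matrix (Fin n) (Fin n) ℝ)⁻¹) := (tendsto_coe_inv (hpos t ht)).comp (hγ t ht)
  have h2 : Tendsto (fun t => (U t : Matrix (Fin n) (Fin n) ℝ)) (𝓝[s] t)
      (𝓝 (U t : Matrix (Fin n) (Fin n) ℝ)) := ((incl n).continuous.tendsto _).comp (hU t ht)
  have h3 : Continuous fun A : Matrix (Fin n) (Fin n) ℝ => A.trace := continuous_id.matrix_trace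
  exact (h3.tendsto _).comp (((h2.mul h1).mul h2).mul h1)

theorem integrableOn_speed {γ : ℝ → SymMat n} {a b : ℝ} (hab : a ≤ b)
    (hγ : ContDiffOn ℝ ∞ γ (Icc a b)) (hpos : ∀ t ∈ Icc a b, γ t ∈ posDef n) :
    IntegrableOn (speed γ) (Icc a b) := by
  rcases hab.eq_or_lt with rfl | hab
  · simp
  have hd : ContinuousOn (derivWithin γ (Icc a b)) (Icc a b) :=
    hγ.continuousOn_derivWithin (uniqueDiffOn_Icc hab) (by simp)
  have hc : ContinuousOn (fun t => Real.sqrt (metric (γ t) (derivWithin γ (Icc a b) t)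
      (derivWithin γ (Icc a b) t))) (Icc a b) :=
    (continuousOn_metric hγ.continuousOn hpos hd).sqrt
  -- At the endpoints the two-sided `deriv` is uncontrolled, but they form a null set.
  rw [integrableOn_Icc_iff_integrableOn_Ioo]
  refine ((hc.integrableOn_compact isCompact_Icc).mono_set Ioo_subset_Icc_self).congr_fun
    (fun t ht => ?_) measurableSet_Ioo
  have hdw : derivWithin γ (Icc a b) t = deriv γ t :=
    derivWithin_of_mem_nhds (Icc_mem_nhds ht.1 ht.2)
  simp only [speed, hdw]

theorem abs_log_quadForm_sub_le_of_contDiffOn {γ : ℝ → SymMat n} {a b : ℝ} (hab : a ≤ b)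
    (hγ : ContDiffOn ℝ ∞ γ (Icc a b)) (hpos : ∀ t ∈ Icc a b, γ t ∈ posDef n) {v : Fin n → ℝ}
    (hv : v ≠ 0) :
    |Real.log (quadForm v (γ b)) - Real.log (quadForm v (γ a))| ≤ ∫ t in a..b, speed γ t := by
  have hint := integrableOn_speed hab hγ hpos
  have hcont : ContinuousOn (fun t => Real.log (quadForm v (γ t))) (Icc a b) :=
    ((quadForm v).continuous.comp_continuousOn hγ.continuousOn).log
      fun t ht => (quadForm_pos (hpos t ht) hv).ne'
  have hder : ∀ t ∈ Ioo a b, HasDerivAt (fun t => Real.log (quadForm v (γ t)))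
      (quadForm v (deriv γ t) / quadForm v (γ t)) t := by
    intro t ht
    have h1 : HasDerivAt γ (deriv γ t) t :=
      ((hγ.contDiffAt (Icc_mem_nhds ht.1 ht.2)).differentiableAt (by simp)).hasDerivAt
    have h2 : HasDerivAt (fun t => quadForm v (γ t)) (quadForm v (deriv γ t)) t :=
      (quadForm v).hasFDerivAt.comp_hasDerivAt t h1
    exact h2.log (quadForm_pos (hpos t (Ioo_subset_Icc_self ht)) hv).ne'
  have hbound : ∀ t ∈ Ioo a b, |quadForm v (deriv γ t) / quadForm v (γ t)| ≤ speed γ t := by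
    intro t ht
    have hp := quadForm_pos (hpos t (Ioo_subset_Icc_self ht)) hv
    rw [abs_div, abs_of_pos hp, div_le_iff₀ hp]
    exact abs_quadForm_le (hpos t (Ioo_subset_Icc_self ht)) _ v
  have hup := intervalIntegral.sub_le_integral_of_hasDeriv_right_of_le hab hcont
    (fun t ht => (hder t ht).hasDerivWithinAt) hint
    (fun t ht => (le_abs_self _).trans (hbound t ht))
  have hdown := intervalIntegral.sub_le_integral_of_hasDeriv_right_of_le hab hcont.neg
    (fun t ht => (hder t ht).neg.hasDerivWithinAt) hint
    (fun t ht => (neg_le_abs _).trans (hbound t ht))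
  simp only [Pi.neg_apply] at hdown
  rw [abs_le]
  constructor <;> linarith

theorem abs_log_quadForm_sub_le_curveLength {γ : ℝ → SymMat n} {a b : ℝ}
    (hγ : IsPiecewiseSmooth γ a b) (hpos : ∀ t ∈ Icc a b, γ t ∈ posDef n) {v : Fin n → ℝ}
    (hv : v ≠ 0) :
    |Real.log (quadForm v (γ b)) - Real.log (quadForm v (γ a))| ≤ curveLength γ a b := by
  obtain ⟨k, τ, hτ, rfl, rfl, hs⟩ := hγ
  have hsub : ∀ i < k, ∀ t ∈ Icc (τ i) (τ (i + 1)), γ t ∈ posDef n := fun i hi t ht =>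
    hpos t ⟨(hτ (Nat.zero_le i)).trans ht.1, ht.2.trans (hτ hi)⟩
  have hint : ∀ i < k, IntervalIntegrable (speed γ) volume (τ i) (τ (i + 1)) := fun i hi =>
    (intervalIntegrable_iff_integrableOn_Icc_of_le (hτ i.le_succ)).2
      (integrableOn_speed (hτ i.le_succ) (hs i hi) (hsub i hi))
  change _ ≤ ∫ t in τ 0..τ k, speed γ t
  rw [← intervalIntegral.sum_integral_adjacent_intervals hint,
    ← Finset.sum_range_sub fun i => Real.log (quadForm v (γ (τ i)))]
  refine (Finset.abs_sum_le_sum_abs _ _).trans (Finset.sum_le_sum fun i hi => ?_)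
  have hi := Finset.mem_range.1 hi
  exact abs_log_quadForm_sub_le_of_contDiffOn (hτ i.le_succ) (hs i hi) (hsub i hi) hv

/-- Without a curve the infimum defining `riemDist` would be `sInf ∅ = 0`, and no lower bound could
hold. -/
theorem exists_curve {Y Z : SymMat n} (hY : Y ∈ posDef n) (hZ : Z ∈ posDef n) :
    ∃ (γ : ℝ → SymMat n) (a b : ℝ), a ≤ b ∧ IsPiecewiseSmooth γ a b ∧
      (∀ t ∈ Icc a b, γ t ∈ posDef n) ∧ γ a = Y ∧ γ b = Z := by
  refine ⟨fun t => (1 - t) • Y + t • Z, 0, 1, zero_le_one,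
    ⟨1, fun i => i, Nat.mono_cast, by simp, by simp, fun i _ => ?_⟩, fun t ht => ?_, by simp,
    by simp⟩
  · exact (((contDiff_const.sub contDiff_id).smul contDiff_const).add
      (contDiff_id.smul contDiff_const)).contDiffOn
  · change ((1 - t) • (Y : Matrix (Fin n) (Fin n) ℝ) + t • (Z : Matrix (Fin n) (Fin n) ℝ)).PosDef
    rcases ht.1.eq_or_lt with rfl | h0
    · have : (Y : Matrix (Fin n) (Fin n) ℝ).PosDef := hY
      simpa using this
    · exact Matrix.PosDef.posSemidef_add
        (Matrix.PosSemidef.smul (Matrix.PosDef.posSemidef hY) (sub_nonneg.2 ht.2))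
        (Matrix.PosDef.smul hZ h0)

theorem abs_log_quadForm_sub_le_riemDist {Y Z : SymMat n} (hY : Y ∈ posDef n) (hZ : Z ∈ posDef n)
    {v : Fin n → ℝ} (hv : v ≠ 0) :
    |Real.log (quadForm v Z) - Real.log (quadForm v Y)| ≤ riemDist Y Z := by
  obtain ⟨γ, a, b, hab, hs, hpos, ha, hb⟩ := exists_curve hY hZ
  refine le_csInf ⟨_, γ, a, b, hab, hs, hpos, ha, hb, rfl⟩ ?_
  rintro _ ⟨γ, a, b, -, hs, hpos, rfl, rfl, rfl⟩
  exact abs_log_quadForm_sub_le_curveLength hs hpos hv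

theorem riemDist_nonneg (Y Z : SymMat n) : 0 ≤ riemDist Y Z := by
  refine Real.sInf_nonneg ?_
  rintro _ ⟨γ, a, b, hab, -, -, -, -, rfl⟩
  exact intervalIntegral.integral_nonneg hab fun t _ => Real.sqrt_nonneg _

theorem abs_quadForm_sub_le {Y Z : SymMat n} (hY : Y ∈ posDef n) (hZ : Z ∈ posDef n)
    (v : Fin n → ℝ) :
    |quadForm v (Z - Y)| ≤ (Real.exp (riemDist Y Z) - 1) * quadForm v Y := by
  rcases eq_or_ne v 0 with rfl | hv
  · simp [quadForm_apply]
  have hy := quadForm_pos hY hv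
  have hz := quadForm_pos hZ hv
  set d := riemDist Y Z
  obtain ⟨h1, h2⟩ := abs_le.1 (abs_log_quadForm_sub_le_riemDist hY hZ hv)
  have h3 : quadForm v Z ≤ Real.exp d * quadForm v Y := by
    rw [← Real.log_le_log_iff hz (by positivity), Real.log_mul (Real.exp_ne_zero d) hy.ne',
      Real.log_exp]
    linarith
  have h4 : quadForm v Y ≤ Real.exp d * quadForm v Z := by
    rw [← Real.log_le_log_iff hy (by positivity), Real.log_mul (Real.exp_ne_zero d) hz.ne',
      Real.log_exp]
    linarith
  rw [map_sub, abs_le]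
  have h5 := Real.add_one_le_exp d
  have h6 : 0 ≤ d := riemDist_nonneg Y Z
  constructor
  · rcases le_total (quadForm v Y) (quadForm v Z) with h | h
    · nlinarith
    · nlinarith
  · linarith

theorem exists_norm_sub_le (n : ℕ) : ∃ C : ℝ, 0 ≤ C ∧ ∀ Y ∈ posDef n, ∀ Z ∈ posDef n,
    ‖Z - Y‖ ≤ C * (Real.exp (riemDist Y Z) - 1) * ‖Y‖ := by
  -- The quadratic forms at `eᵢ + eⱼ`, including `i = j`, determine a symmetric matrix by
  -- polarization; finite dimension turns injectivity into a norm bound.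
  let Q : SymMat n →ₗ[ℝ] (Fin n × Fin n → ℝ) :=
    LinearMap.pi fun p => (quadForm (Pi.single p.1 1 + Pi.single p.2 1)).toLinearMap
  have hQ : ∀ D p, Q D p = (D : Matrix (Fin n) (Fin n) ℝ) p.1 p.1 +
      (D : Matrix (Fin n) (Fin n) ℝ) p.2 p.2 + 2 * (D : Matrix (Fin n) (Fin n) ℝ) p.1 p.2 := by
    intro D p
    have hsymm : (D : Matrix (Fin n) (Fin n) ℝ) p.2 p.1 = (D : Matrix (Fin n) (Fin n) ℝ) p.1 p.2 :=
      congrFun (congrFun (isSymm_coe D) p.1) p.2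
    change quadForm _ D = _
    rw [quadForm_apply]
    simp only [Matrix.mulVec_add, add_dotProduct, dotProduct_add, Matrix.mulVec_single_one,
      single_one_dotProduct, Matrix.col_apply, hsymm]
    ring
  have hker : LinearMap.ker Q = ⊥ := by
    refine LinearMap.ker_eq_bot'.2 fun D hD => ?_
    have h0 : ∀ i j, Q D (i, j) = 0 := fun i j => by rw [hD]; rfl
    simp only [hQ] at h0
    ext i j
    have h1 := h0 i i
    have h2 := h0 j j
    have h3 := h0 i j
    change (D : Matrix (Fin n) (Fin n) ℝ) i j = 0
    linarith
  obtain ⟨K, -, hK⟩ := Q.exists_antilipschitzWith hker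
  obtain ⟨M, hM0, hM⟩ : ∃ M : ℝ, 0 < M ∧ ∀ Y, ‖Q Y‖ ≤ M * ‖Y‖ :=
    SemilinearMapClass.bound_of_continuous Q Q.continuous_of_finiteDimensional
  refine ⟨K * M, by positivity, fun Y hY Z hZ => ?_⟩
  have hexp : 0 ≤ Real.exp (riemDist Y Z) - 1 := by
    have := Real.add_one_le_exp (riemDist Y Z)
    linarith [riemDist_nonneg Y Z]
  have h1 : ‖Z - Y‖ ≤ K * ‖Q (Z - Y)‖ := hK.le_mul_norm (map_zero Q) _
  have h2 : ‖Q (Z - Y)‖ ≤ (Real.exp (riemDist Y Z) - 1) * ‖Q Y‖ := by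
    refine (pi_norm_le_iff_of_nonneg (by positivity)).2 fun p => ?_
    refine (abs_quadForm_sub_le hY hZ _).trans (mul_le_mul_of_nonneg_left ?_ hexp)
    exact (le_abs_self _).trans (norm_le_pi_norm (Q Y) p)
  calc ‖Z - Y‖ ≤ K * ‖Q (Z - Y)‖ := h1
    _ ≤ K * ((Real.exp (riemDist Y Z) - 1) * (M * ‖Y‖)) := by
      gcongr; exact h2.trans (mul_le_mul_of_nonneg_left (hM Y) hexp)
    _ = _ := by ring

end SPD

/-! ### Local Lipschitz continuity of a maximum -/

namespace SPD

variable {n : ℕ} {ι : Type*} [Fintype ι] [Nonempty ι] {F : ι → SymMat n → ℝ}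

theorem maxFun_sub_le {F : ι → SymMat n → ℝ} {Y Z : SymMat n} {c : ℝ}
    (h : ∀ i, F i Y - F i Z ≤ c) : maxFun F Y - maxFun F Z ≤ c := by
  obtain ⟨i, hi⟩ := exists_eq_maxFun F Y
  rw [← hi]
  exact (sub_le_sub_left (le_maxFun F i Z) _).trans (h i)

theorem exists_lipschitz_maxFun {X : SymMat n} (hF : ∀ i, ContDiffAt ℝ 1 (F i) X) :
    ∃ K : ℝ, 0 ≤ K ∧ ∃ r : ℝ, 0 < r ∧ ∀ Y Z : SymMat n, ‖Y - X‖ < r → ‖Z - X‖ < r →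
      |maxFun F Y - maxFun F Z| ≤ K * ‖Z - Y‖ := by
  have h1 : ∀ i, ∃ K : NNReal, ∃ s ∈ 𝓝 X, LipschitzOnWith K (F i) s := fun i =>
    ((hF i).hasStrictFDerivAt (by simp)).exists_lipschitzOnWith
  choose K s hs hL using h1
  obtain ⟨r, hr, hball⟩ := Metric.mem_nhds_iff.1 (Filter.iInter_mem.2 hs)
  refine ⟨∑ i, (K i : ℝ), by positivity, r, hr, fun Y Z hY hZ => ?_⟩
  have hmem : ∀ {W : SymMat n}, ‖W - X‖ < r → ∀ i, W ∈ s i := fun hW i =>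
    Set.mem_iInter.1 (hball (mem_ball_iff_norm.2 hW)) i
  have hi : ∀ i, |F i Y - F i Z| ≤ (∑ i, (K i : ℝ)) * ‖Z - Y‖ := fun i => by
    have h2 := (hL i).dist_le_mul Y (hmem hY i) Z (hmem hZ i)
    rw [Real.dist_eq, dist_eq_norm, norm_sub_rev] at h2
    exact h2.trans (mul_le_mul_of_nonneg_right
      (Finset.single_le_sum (f := fun i => (K i : ℝ)) (fun i _ => NNReal.coe_nonneg _)
        (Finset.mem_univ i)) (norm_nonneg _))
  exact abs_sub_le_iff.2 ⟨maxFun_sub_le fun i => (le_abs_self _).trans (hi i),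
    maxFun_sub_le fun i => (le_abs_self _).trans (abs_sub_comm (F i Z) (F i Y) ▸ hi i)⟩

theorem locallyLipschitzOnRiem_maxFun {Ω : Set (SymMat n)} (hΩM : Ω ⊆ posDef n)
    (hF : ∀ X ∈ Ω, ∀ i, ContDiffAt ℝ 1 (F i) X) : LocallyLipschitzOnRiem (maxFun F) Ω := by
  intro X hX
  obtain ⟨K, hK, r, hr, hlip⟩ := exists_lipschitz_maxFun (hF X hX)
  obtain ⟨C, hC, hnorm⟩ := exists_norm_sub_le n
  have hlim : ∀ x : ℝ, Tendsto (fun d : ℝ => C * (Real.exp d - 1) * x) (𝓝 0) (𝓝 0) := by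
    intro x
    have : Continuous fun d : ℝ => C * (Real.exp d - 1) * x := by fun_prop
    simpa using this.tendsto 0
  obtain ⟨δ, hδ, hball⟩ := Metric.eventually_nhds_iff.1 ((hlim ‖X‖).eventually_lt_const hr)
  have hclose : ∀ Y ∈ posDef n, riemDist X Y < δ → ‖Y - X‖ < r := fun Y hY hd =>
    (hnorm X (hΩM hX) Y hY).trans_lt (hball (by
      rwa [Real.dist_eq, sub_zero, abs_of_nonneg (riemDist_nonneg X Y)]))
  -- The first summand covers `d ≤ 1`, where `e^d - 1 ≤ 2d` and `‖Y‖ ≤ ‖X‖ + r`; the second covers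
  -- `d ≥ 1`, where `‖Z - Y‖ ≤ 2r ≤ 2rd`. The split dispenses with a triangle inequality for
  -- `riemDist`.
  refine ⟨K * (2 * C * (‖X‖ + r) + 2 * r), by positivity, δ, hδ, fun Y hY Z hZ hXY hXZ => ?_⟩
  have hYr := hclose Y hY hXY
  have hZr := hclose Z hZ hXZ
  refine (hlip Y Z hYr hZr).trans ?_
  rw [mul_assoc]
  refine mul_le_mul_of_nonneg_left ?_ hK
  have hd := riemDist_nonneg Y Z
  set d := riemDist Y Z with hd_def
  have hYnorm : ‖Y‖ ≤ ‖X‖ + r := by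
    have h := norm_add_le (Y - X) X
    rw [sub_add_cancel] at h
    linarith
  rw [add_mul]
  rcases le_total d 1 with h1 | h1
  · have hexp : Real.exp d - 1 ≤ 2 * d := by
      have h := Real.abs_exp_sub_one_le (x := d) (by rwa [abs_of_nonneg hd])
      rw [abs_of_nonneg hd] at h
      exact (le_abs_self _).trans h
    have h2 : C * (Real.exp d - 1) * ‖Y‖ ≤ C * (2 * d) * (‖X‖ + r) := by gcongr
    have h3 : 0 ≤ 2 * r * d := by positivity
    linarith [hnorm Y hY Z hZ]
  · have h2 : ‖Z - Y‖ ≤ ‖Z - X‖ + ‖Y - X‖ := by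
      have h := norm_sub_le (Z - X) (Y - X)
      rwa [sub_sub_sub_cancel_right] at h
    have h3 : 2 * r * 1 ≤ 2 * r * d := by gcongr
    have h4 : 0 ≤ 2 * C * (‖X‖ + r) * d := by positivity
    linarith

end SPD

theorem mainTheorem5 {n : ℕ} {ι : Type*} [Fintype ι] [Nonempty ι]
    (Ω : Set (SPD.SymMat n)) (hΩ : IsOpen Ω) (hΩM : Ω ⊆ SPD.posDef n)
    (F : ι → SPD.SymMat n → ℝ) (hF : ∀ i, ContDiffOn ℝ 1 (F i) Ω) :
    SPD.LocallyLipschitzOnRiem (SPD.maxFun F) Ω ∧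
      ∀ X ∈ Ω, SPD.clarkeSubdiff (SPD.maxFun F) X =
        convexHull ℝ {G | ∃ i, F i X = SPD.maxFun F X ∧ G = SPD.riemGrad (F i) X} := by
  have hF' : ∀ X ∈ Ω, ∀ i, ContDiffAt ℝ 1 (F i) X := fun X hX i =>
    (hF i).contDiffAt (hΩ.mem_nhds hX)
  exact ⟨SPD.locallyLipschitzOnRiem_maxFun hΩM hF',
    fun X hX => SPD.clarkeSubdiff_maxFun (hΩM hX) (hF' X hX)⟩
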